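/- Let $b,\sigma,\rho,c,\alpha>0$ and $a<\hat a$ be real constants. Let $W$ be a standard one-dimensional Brownian motion on a probability space $(\Omega,\mathcal F,\mathbb P)$ and let $\mathbb F$ be its filtration, augmented by the $\mathbb P$-null sets. For $q\in\mathbb R$ let $$\psi(x;q)=e^{\frac{(bx-q)^2}{2\sigma^2 b}}\,D_{-\rho/b}\Big(-\frac{bx-q}{\sigma b}\sqrt{2b}\Big),\qquad D_\beta(z)=\frac{e^{-z^2/4}}{\Gamma(-\beta)}\int_0^\infty t^{-\beta-1}e^{-t^2/2-zt}\,dt\quad(\beta<0),$$ the strictly increasing positive fundamental solution of $\frac{\sigma^2}{2}u''+(q-bx)u'-\rho u=0$. For $y\ge 0$ let $\mathcal A(y)$ be the set of $\mathbb F$-adapted processes $\xi$ which almost surely have increasing, right-continuous paths with values in $[0,y]$, and put $\xi_{0-}=0$. For $x\in\mathbb R$, $\xi\in\mathcal A(y)$ and $q\in\mathbb R$ let $X^{x,\xi;q}$ be the (unique, adapted, càdlàg) solution of $$dX_t=(q-bX_t)\,dt+\sigma\,dW_t-\alpha\,d\xi_t,\qquad X_{0-}=x,$$ and, with $\Delta\xi_t=\xi_t-\xi_{t-}$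 and $\xi^c$ the continuous part of $\xi$, let $$V(x,y;q)=\sup_{\xi\in\mathcal A(y)}\mathbb E\Big[\int_0^\infty e^{-\rho t}\big(X^{x,\xi;q}_t-c\big)\,d\xi^c_t+\sum_{t\ge 0:\,\Delta\xi_t\ne 0}e^{-\rho t}\Big(\big(X^{x,\xi;q}_{t-}-c\big)\Delta\xi_t-\tfrac12\alpha(\Delta\xi_t)^2\Big)\Big].$$ Then the following hold. 1. For $q\in\{a,\hat a\}$ the equation $(x-c)\,\psi_x(x;q)-\psi(x;q)=0$ has exactly one solution in $(c,\infty)$; denoting it by $x_0$ for $q=a$ and by $\hat x_0$ for $q=\hat a$, one has $\hat x_0>x_0$. 2. For $q\in\{a,\hat a\}$ the equation $(x-c)\,\psi_{xx}(x;q)-\psi_x(x;q)=0$ has exactly one solution in $(c,\infty)$; denoting it by $x_\infty$ for $q=a$ and by $\hat x_\infty$ for $q=\hat a$, one has $\hat x_\infty>x_\infty$. 3. For all $x\in\mathbb R$, $y\ge 0$ and $\xi\in\mathcal A(y)$, the controlled prices $X^{x,\xi;a}$ and $X^{x,\xi;\hat a}$ exist, and almost surely $X^{x,\xi;\hat a}_t\ge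 X^{x,\xi;a}_t$ for all $t\ge 0$. 4. $V(x,y;\hat a)\ge V(x,y;a)$ for all $(x,y)\in\mathbb R\times[0,\infty)$. -/

import Mathlib

open MeasureTheory ProbabilityTheory Filter Topology Set
open scoped NNReal ENNReal

namespace OptimalExtraction

noncomputable section

/-! ### The increasing fundamental solution of the Ornstein-Uhlenbeck equation -/

/-- The cylinder function `D_β`, for `β < 0`. -/
def cylinderD (β x : ℝ) : ℝ :=
  Real.exp (-x ^ 2 / 4) / Real.Gamma (-β) *
    ∫ t in Ioi (0 : ℝ), t ^ (-β - 1) * Real.exp (-t ^ 2 / 2 - x * t)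

/-- The function `x ↦ ψ(x; a, σ)`: the strictly increasing positive solution of
`(σ² / 2) u'' + (a - b x) u' - ρ u = 0`. -/
def psi (a b σ ρ x : ℝ) : ℝ :=
  Real.exp ((b * x - a) ^ 2 / (2 * σ ^ 2 * b)) *
    cylinderD (-ρ / b) (-((b * x - a) / (σ * b)) * √(2 * b))

/-! ### Paths on `[0, ∞)` -/

/-- The left limit `f(t-)`, with the prescribed value `f(0-) = z` at time zero. -/
def leftValue (z : ℝ) (f : ℝ≥0 → ℝ) (t : ℝ≥0) : ℝ :=
  if t = 0 then z else Function.leftLim f t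

/-- The jump `Δk(t) = k(t) - k(t-)` of a control path, where `k(0-) = 0`. -/
def jump (k : ℝ≥0 → ℝ) (t : ℝ≥0) : ℝ := k t - leftValue 0 k t

/-- The continuous part `k^c(t) = k(t) - ∑_{s ≤ t} Δk(s)` of a control path. -/
def continuousPart (k : ℝ≥0 → ℝ) (t : ℝ≥0) : ℝ := k t - ∑' s : Iic t, jump k s

open Classical in
/-- The Lebesgue-Stieltjes measure `dk^c` on `[0, ∞)`. The continuous part of an increasing
right-continuous path is increasing, so that the first case applies to such paths. -/
def continuousPartMeasure (k : ℝ≥0 → ℝ) : Measure ℝ≥0 :=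
  if h : Monotone (continuousPart k) then h.stieltjesFunction.measure else 0

/-- The discounted net profit along a control path `k` and a price path `p` with `p(0-) = x`. -/
def pathProfit (ρ c α x : ℝ) (k p : ℝ≥0 → ℝ) : ℝ :=
  (∫ t : ℝ≥0, Real.exp (-ρ * t) * (p t - c) ∂(continuousPartMeasure k)) +
    ∑' t : {t : ℝ≥0 // jump k t ≠ 0},
      Real.exp (-ρ * (t : ℝ≥0)) *
        ((leftValue x p t - c) * jump k t - 1 / 2 * α * jump k t ^ 2)

/-! ### The stochastic control problem -/

variable {Ω : Type*} [mΩ : MeasurableSpace Ω]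

/-- The filtration generated by `W`, augmented by the `P`-null sets. -/
def augmentedFiltration (P : Measure Ω) (W : ℝ≥0 → Ω → ℝ) (hW : ∀ t, Measurable (W t)) :
    Filtration ℝ≥0 mΩ where
  seq t := (⨆ s ≤ t, MeasurableSpace.comap (W s) (borel ℝ)) ⊔
    MeasurableSpace.generateFrom {N | MeasurableSet N ∧ P N = 0}
  mono' _ _ hst := sup_le_sup_right (biSup_mono fun _ hr => hr.trans hst) _
  le' t := by
    refine sup_le (iSup₂_le fun s _ => ?_) (MeasurableSpace.generateFrom_le fun N hN => hN.1)
    rw [← BorelSpace.measurable_eq (α := ℝ)]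
    exact (hW s).comap_le

/-- The set `𝒜(y)` of admissible extraction strategies. Left limits of the paths exist by
monotonicity, and `ξ_{0-} = 0` is the convention used in `jump`. -/
structure IsAdmissible (𝓕 : Filtration ℝ≥0 mΩ) (P : Measure Ω) (y : ℝ) (ξ : ℝ≥0 → Ω → ℝ) :
    Prop where
  adapted : StronglyAdapted 𝓕 ξ
  mono : ∀ᵐ ω ∂P, Monotone fun t => ξ t ω
  rightCont : ∀ᵐ ω ∂P, ∀ t, ContinuousWithinAt (fun s => ξ s ω) (Ici t) t
  nonneg : ∀ᵐ ω ∂P, ∀ t, 0 ≤ ξ t ω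
  le : ∀ᵐ ω ∂P, ∀ t, ξ t ω ≤ y

/-- `X` is a strong (adapted, càdlàg) solution `X^{x,ξ}` of
`dX_t = (a - b X_t) dt + σ dW_t - α dξ_t`, `X_{0-} = x`. -/
structure IsPrice (𝓕 : Filtration ℝ≥0 mΩ) (P : Measure Ω) (W : ℝ≥0 → Ω → ℝ)
    (a b σ α x : ℝ) (ξ X : ℝ≥0 → Ω → ℝ) : Prop where
  adapted : StronglyAdapted 𝓕 X
  cadlag : ∀ᵐ ω ∂P, ∀ t, ContinuousWithinAt (fun s => X s ω) (Ici t) t ∧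
    ∃ l, Tendsto (fun s => X s ω) (𝓝[<] t) (𝓝 l)
  eqn : ∀ᵐ ω ∂P, ∀ t : ℝ≥0,
    X t ω = x + (∫ s in (0 : ℝ)..t, (a - b * X s.toNNReal ω)) + σ * W t ω - α * ξ t ω

/-- The expectation `E[Z] = E[Z⁺] - E[Z⁻]` with values in `[-∞, ∞]`. -/
def expectation (P : Measure Ω) (Z : Ω → ℝ) : EReal :=
  ((∫⁻ ω, ENNReal.ofReal (Z ω) ∂P : ℝ≥0∞) : EReal) -
    ((∫⁻ ω, ENNReal.ofReal (-Z ω) ∂P : ℝ≥0∞) : EReal)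

/-- The performance `J(x, y, ξ)` of a strategy `ξ`, where `X` is the price `X^{x,ξ}`. -/
def performance (P : Measure Ω) (ρ c α x : ℝ) (ξ X : ℝ≥0 → Ω → ℝ) : EReal :=
  expectation P fun ω => pathProfit ρ c α x (fun t => ξ t ω) (fun t => X t ω)

/-- The value function `V(x, y)`: the supremum of `J(x, y, ξ)` over `ξ ∈ 𝒜(y)`. -/
def value (𝓕 : Filtration ℝ≥0 mΩ) (P : Measure Ω) (W : ℝ≥0 → Ω → ℝ)
    (a b σ ρ c α x y : ℝ) : EReal :=
  sSup {v | ∃ ξ X : ℝ≥0 → Ω → ℝ, IsAdmissible 𝓕 P y ξ ∧ IsPrice 𝓕 P W a b σ α x ξ X ∧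
    v = performance P ρ c α x ξ X}

end

end OptimalExtraction

namespace OptimalExtraction

/-! ### Roots of `(x - c) f' - f` -/

/-! Up to a positive constant, `psi` is the integral of `t ^ (s - 1) * exp (-t ^ 2 / 2 + w * t)`
over `t > 0`, with `s = ρ / b` and `w` an increasing affine function of `x - a / b` (`psi_eq`). Each
derivative raises `s` by one, so all derivatives are positive and increasing.

For `f` a derivative of `psi` of order 0 or 1, `(x - c) f' - f` is negative at `c`, strictly
increasing beyond it and eventually positive, hence has one root, where `x - c = f / f'`. By strict
Cauchy–Schwarz (`gaussianMellin_sq_lt`) the quotient `f / f'` decreases in `w`. A larger `a` lowers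
`w`, hence raises `f / f'` and moves the root to the right.

Under a common control, the difference of two prices contains neither noise nor control: it equals
`(a' - a) / b * (1 - exp (-b t))`, which is nonnegative and bounded (`IsPrice.ae_eq_add`). Profit
increases with the price path (`pathProfit_le_pathProfit_add`), and the admissible controls do not
depend on `a`, so the suprema compare. -/

theorem strictMonoOn_sub_mul_deriv_sub {c : ℝ} {f f' f'' : ℝ → ℝ}
    (hf : ∀ x, HasDerivAt f (f' x) x) (hf' : ∀ x, HasDerivAt f' (f'' x) x)
    (hpos : ∀ x, 0 < f'' x) : StrictMonoOn (fun x => (x - c) * f' x - f x) (Ici c) := by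
  have hd : ∀ x, HasDerivAt (fun x => (x - c) * f' x - f x) ((x - c) * f'' x) x := fun x => by
    exact ((((hasDerivAt_id' x).sub_const c).mul (hf' x)).sub (hf x)).congr_deriv (by ring)
  refine strictMonoOn_of_deriv_pos (convex_Ici c)
    (fun x _ => (hd x).continuousAt.continuousWithinAt) fun x hx => ?_
  rw [interior_Ici] at hx
  rw [(hd x).deriv]
  exact mul_pos (sub_pos.2 hx) (hpos x)

/-- Uniqueness is strict monotonicity. Existence needs a point where the function is positive, which
the lower bound `f'' c` for `f''` on the right of `c` supplies. -/
theorem exists_root_sub_mul_deriv_sub {c : ℝ} {f f' f'' : ℝ → ℝ}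
    (hf : ∀ x, HasDerivAt f (f' x) x) (hf' : ∀ x, HasDerivAt f' (f'' x) x)
    (hf0 : ∀ x, 0 < f x) (hf'0 : ∀ x, 0 < f' x) (hpos : ∀ x, 0 < f'' x) (hmono : Monotone f'') :
    ∃ x₀, {x | c < x ∧ (x - c) * f' x - f x = 0} = {x₀} := by
  have hmono' : Monotone f' :=
    monotone_of_deriv_nonneg (fun x => (hf' x).differentiableAt)
      fun x => by rw [(hf' x).deriv]; exact (hpos x).le
  have hs := strictMonoOn_sub_mul_deriv_sub (c := c) hf hf' hpos
  set H : ℝ → ℝ := fun x => (x - c) * f' x - f x with hH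
  have hcont : Continuous H := by
    have h1 : Continuous f := continuous_iff_continuousAt.2 fun x => (hf x).continuousAt
    have h2 : Continuous f' := continuous_iff_continuousAt.2 fun x => (hf' x).continuousAt
    fun_prop
  have hHc : H c < 0 := by simp [hH, hf0 c]
  -- With this choice `f'' c * (X - c) = f'' c + f (c + 1)`, which forces `f' X > f (c + 1)`.
  -- Convexity gives `H X ≥ f' X - f (c + 1)`.
  set X : ℝ := c + 1 + f (c + 1) / f'' c with hX
  have hq : 0 < f (c + 1) / f'' c := div_pos (hf0 _) (hpos c)
  have hX1 : c + 1 < X := by linarith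
  have hHX : 0 < H X := by
    obtain ⟨u, hu, hu'⟩ := exists_hasDerivAt_eq_slope f f' hX1
      (fun x _ => (hf x).continuousAt.continuousWithinAt) fun x _ => hf x
    obtain ⟨v, hv, hv'⟩ := exists_hasDerivAt_eq_slope f' f'' (show c < X by linarith)
      (fun x _ => (hf' x).continuousAt.continuousWithinAt) fun x _ => hf' x
    rw [eq_div_iff (by linarith)] at hu' hv'
    have e1 : f X ≤ f (c + 1) + (X - (c + 1)) * f' X := by
      nlinarith [hmono' hu.2.le]
    have e2 : f'' c * (X - c) ≤ f' X - f' c := by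
      rw [← hv']
      exact mul_le_mul_of_nonneg_right (hmono hv.1.le) (by linarith)
    have e3 : f'' c * (X - c) = f'' c + f (c + 1) := by
      rw [hX]; field_simp [(hpos c).ne']; ring
    have := hf'0 c
    have := hpos c
    simp only [hH]
    nlinarith
  obtain ⟨x₀, hx₀, h0⟩ := intermediate_value_Icc (show c ≤ X by linarith) hcont.continuousOn
    (show (0 : ℝ) ∈ Icc (H c) (H X) from ⟨hHc.le, hHX.le⟩)
  have hx₀c : c < x₀ := lt_of_le_of_ne hx₀.1 fun h => by subst h; linarith
  refine ⟨x₀, Set.eq_singleton_iff_unique_mem.2 ⟨⟨hx₀c, h0⟩, fun x hx => ?_⟩⟩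
  exact hs.injOn hx.1.le hx₀c.le (hx.2.trans h0.symm)

/-- The hypothesis `hfg` says `f / f' < g / g'`. At the root for `f`, the increasing function
attached to `g` is therefore still negative. -/
theorem exists_roots_lt {c : ℝ} {f f' f'' g g' g'' : ℝ → ℝ}
    (hf : ∀ x, HasDerivAt f (f' x) x) (hf' : ∀ x, HasDerivAt f' (f'' x) x)
    (hf0 : ∀ x, 0 < f x) (hf'0 : ∀ x, 0 < f' x) (hfpos : ∀ x, 0 < f'' x) (hfmono : Monotone f'')
    (hg : ∀ x, HasDerivAt g (g' x) x) (hg' : ∀ x, HasDerivAt g' (g'' x) x)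
    (hg0 : ∀ x, 0 < g x) (hg'0 : ∀ x, 0 < g' x) (hgpos : ∀ x, 0 < g'' x) (hgmono : Monotone g'')
    (hfg : ∀ x, f x * g' x < g x * f' x) :
    ∃ x₀ x₀', {x | c < x ∧ (x - c) * f' x - f x = 0} = {x₀} ∧
      {x | c < x ∧ (x - c) * g' x - g x = 0} = {x₀'} ∧ x₀ < x₀' := by
  obtain ⟨x₀, h⟩ := exists_root_sub_mul_deriv_sub (c := c) hf hf' hf0 hf'0 hfpos hfmono
  obtain ⟨x₀', h'⟩ := exists_root_sub_mul_deriv_sub (c := c) hg hg' hg0 hg'0 hgpos hgmono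
  refine ⟨x₀, x₀', h, h', ?_⟩
  obtain ⟨hc, hr⟩ : c < x₀ ∧ (x₀ - c) * f' x₀ - f x₀ = 0 := h.ge rfl
  obtain ⟨hc', hr'⟩ : c < x₀' ∧ (x₀' - c) * g' x₀' - g x₀' = 0 := h'.ge rfl
  by_contra! hle
  have h1 := (strictMonoOn_sub_mul_deriv_sub (c := c) hg hg' hgpos).monotoneOn hc'.le hc.le hle
  simp only [hr'] at h1
  have h2 : f x₀ * g' x₀ = (x₀ - c) * g' x₀ * f' x₀ := by
    rw [← sub_eq_zero.1 hr]; ring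
  nlinarith [hfg x₀, hf'0 x₀]

/-! ### The integral representation of the fundamental solution -/

noncomputable section

/-- The Laplace transform `w ↦ ∫₀^∞ t^(s-1) exp(-t²/2 + w t) dt`. -/
def gaussianMellin (s w : ℝ) : ℝ :=
  ∫ t in Ioi (0 : ℝ), t ^ (s - 1) * Real.exp (-t ^ 2 / 2 + w * t)

theorem integrableOn_gaussianMellin {s : ℝ} (hs : 0 < s) (w : ℝ) :
    IntegrableOn (fun t : ℝ => t ^ (s - 1) * Real.exp (-t ^ 2 / 2 + w * t)) (Ioi 0) := by
  -- Completing the square: `-t ^ 2 / 2 + w t ≤ w ^ 2 - t ^ 2 / 4`.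
  have h := (integrableOn_rpow_mul_exp_neg_mul_sq (b := 1 / 4) (by norm_num)
    (show -1 < s - 1 by linarith)).const_mul (Real.exp (w ^ 2))
  refine Integrable.mono' h (by fun_prop) ?_
  filter_upwards [ae_restrict_mem measurableSet_Ioi] with t ht
  have ht' : (0 : ℝ) < t := ht
  rw [Real.norm_of_nonneg (by positivity), mul_left_comm, ← Real.exp_add]
  refine mul_le_mul_of_nonneg_left (Real.exp_le_exp.2 ?_) (by positivity)
  nlinarith [sq_nonneg (t / 2 - w)]

/-- Differentiation under the integral brings down a factor `t`. On the unit ball around `w`, the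
integrand at `w + 1` dominates. -/
theorem hasDerivAt_gaussianMellin {s : ℝ} (hs : 0 < s) (w : ℝ) :
    HasDerivAt (gaussianMellin s) (gaussianMellin (s + 1) w) w := by
  refine (hasDerivAt_integral_of_dominated_loc_of_deriv_le (s := Metric.ball w 1)
    (μ := volume.restrict (Ioi (0 : ℝ)))
    (F := fun v t => t ^ (s - 1) * Real.exp (-t ^ 2 / 2 + v * t))
    (F' := fun v t => t ^ (s + 1 - 1) * Real.exp (-t ^ 2 / 2 + v * t))
    (bound := fun t => t ^ (s + 1 - 1) * Real.exp (-t ^ 2 / 2 + (w + 1) * t))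
    (Metric.ball_mem_nhds w one_pos) (Eventually.of_forall fun v => by fun_prop)
    (integrableOn_gaussianMellin hs w) (by fun_prop) ?_
    (integrableOn_gaussianMellin (by linarith) _) ?_).2
  · filter_upwards [ae_restrict_mem measurableSet_Ioi] with t ht v hv
    have ht' : (0 : ℝ) < t := ht
    have hv' : v ≤ w + 1 := by
      have := (abs_lt.1 (Real.dist_eq v w ▸ Metric.mem_ball.1 hv)).2
      linarith
    rw [Real.norm_of_nonneg (by positivity)]
    gcongr
  · filter_upwards [ae_restrict_mem measurableSet_Ioi] with t ht v _
    have ht' : (0 : ℝ) < t := ht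
    refine (((((hasDerivAt_id' v).mul_const t).const_add (-t ^ 2 / 2)).exp).const_mul
      (t ^ (s - 1))).congr_deriv ?_
    rw [show s + 1 - 1 = s - 1 + 1 by ring, Real.rpow_add_one ht'.ne']
    ring

/-- The exceptional point `l` accommodates integrands with a factor `(t - l) ^ 2`. -/
theorem setIntegral_Ioi_pos {f : ℝ → ℝ} (hf : IntegrableOn f (Ioi 0)) (l : ℝ)
    (h0 : ∀ t, 0 < t → 0 ≤ f t) (hpos : ∀ t, 0 < t → t ≠ l → 0 < f t) :
    0 < ∫ t in Ioi (0 : ℝ), f t := by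
  rw [setIntegral_pos_iff_support_of_nonneg_ae _ hf]
  · have hsub : Ioo (max 0 l) (max 0 l + 1) ⊆ Function.support f ∩ Ioi 0 := fun t ht => by
      have h1 := max_lt_iff.1 ht.1
      exact ⟨(hpos t h1.1 h1.2.ne').ne', h1.1⟩
    refine lt_of_lt_of_le ?_ (measure_mono hsub)
    simp
  · filter_upwards [ae_restrict_mem measurableSet_Ioi] with t ht using h0 t ht

theorem gaussianMellin_pos {s : ℝ} (hs : 0 < s) (w : ℝ) : 0 < gaussianMellin s w :=
  setIntegral_Ioi_pos (integrableOn_gaussianMellin hs w) 0 (fun t ht => by positivity)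
    fun t ht _ => by positivity

/-- Strict Cauchy–Schwarz: the weighted integral of `(t - l) ^ 2` is positive, and `l`, the mean of
`t`, minimizes it. -/
theorem gaussianMellin_sq_lt {s : ℝ} (hs : 0 < s) (w : ℝ) :
    gaussianMellin (s + 1) w ^ 2 < gaussianMellin s w * gaussianMellin (s + 1 + 1) w := by
  set l := gaussianMellin (s + 1) w / gaussianMellin s w with hl
  have i0 := integrableOn_gaussianMellin hs w
  have i1 := integrableOn_gaussianMellin (show 0 < s + 1 by linarith) w
  have i2 := integrableOn_gaussianMellin (show 0 < s + 1 + 1 by linarith) w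
  have key : 0 < gaussianMellin (s + 1 + 1) w - 2 * l * gaussianMellin (s + 1) w
      + l ^ 2 * gaussianMellin s w := by
    have hval : ∀ t : ℝ, 0 < t → t ^ (s + 1 + 1 - 1) * Real.exp (-t ^ 2 / 2 + w * t)
        - 2 * l * (t ^ (s + 1 - 1) * Real.exp (-t ^ 2 / 2 + w * t))
        + l ^ 2 * (t ^ (s - 1) * Real.exp (-t ^ 2 / 2 + w * t))
        = (t - l) ^ 2 * (t ^ (s - 1) * Real.exp (-t ^ 2 / 2 + w * t)) := fun t ht => by
      rw [show s + 1 + 1 - 1 = s - 1 + 1 + 1 by ring, show s + 1 - 1 = s - 1 + 1 by ring,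
        Real.rpow_add_one ht.ne', Real.rpow_add_one ht.ne']
      ring
    have i12 : IntegrableOn (fun t : ℝ => t ^ (s + 1 + 1 - 1) * Real.exp (-t ^ 2 / 2 + w * t)
        - 2 * l * (t ^ (s + 1 - 1) * Real.exp (-t ^ 2 / 2 + w * t))) (Ioi 0) :=
      i2.sub (i1.const_mul (2 * l))
    have h := setIntegral_Ioi_pos (i12.add (i0.const_mul (l ^ 2))) l
      (fun t ht => (hval t ht).ge.trans' (by positivity))
      fun t ht htl => (hval t ht).ge.trans_lt' (by
        have : 0 < (t - l) ^ 2 := by have := sub_ne_zero.2 htl; positivity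
        positivity)
    simp only [Pi.add_apply] at h
    rwa [integral_add i12 (i0.const_mul _), integral_sub i2 (i1.const_mul _),
      integral_const_mul, integral_const_mul] at h
  have h0 := gaussianMellin_pos hs w
  rw [hl] at key
  field_simp at key
  nlinarith

theorem strictAnti_gaussianMellin_div {s : ℝ} (hs : 0 < s) :
    StrictAnti fun w => gaussianMellin s w / gaussianMellin (s + 1) w := by
  refine strictAnti_of_deriv_neg fun w => ?_
  have h1 := gaussianMellin_pos (show 0 < s + 1 by linarith) w
  have h := (hasDerivAt_gaussianMellin hs w).div
    (hasDerivAt_gaussianMellin (show 0 < s + 1 by linarith) w) h1.ne'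
  erw [h.deriv]
  refine div_neg_of_neg_of_pos ?_ (by positivity)
  nlinarith [gaussianMellin_sq_lt hs w]

theorem psi_eq {b σ : ℝ} (hb : 0 < b) (hσ : 0 < σ) (a ρ x : ℝ) :
    psi a b σ ρ x =
      (Real.Gamma (ρ / b))⁻¹ * gaussianMellin (ρ / b) (√(2 * b) / σ * (x - a / b)) := by
  have hz : -((b * x - a) / (σ * b)) * √(2 * b) = -(√(2 * b) / σ * (x - a / b)) := by
    field_simp
  have hsq : (√(2 * b)) ^ 2 = 2 * b := Real.sq_sqrt (by positivity)
  -- The exponential prefactor of `psi` cancels the one inside `cylinderD`.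
  have he : Real.exp ((b * x - a) ^ 2 / (2 * σ ^ 2 * b)) *
      Real.exp (-(-((b * x - a) / (σ * b)) * √(2 * b)) ^ 2 / 4) = 1 := by
    rw [← Real.exp_add, mul_pow, hsq, Real.exp_eq_one_iff]
    field_simp
    ring
  have hI : (∫ t in Ioi (0 : ℝ), t ^ (-(-ρ / b) - 1) *
      Real.exp (-t ^ 2 / 2 - -((b * x - a) / (σ * b)) * √(2 * b) * t))
      = gaussianMellin (ρ / b) (√(2 * b) / σ * (x - a / b)) := by
    rw [hz, gaussianMellin, neg_div, neg_neg]
    simp only [neg_mul, sub_neg_eq_add]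
  rw [psi, cylinderD, hI, ← mul_assoc, ← mul_div_assoc, he, neg_div, neg_neg, one_div]

/-- The `n`-th derivative of `psi`, as an integral. -/
def psiDeriv (a b σ ρ : ℝ) (n : ℕ) (x : ℝ) : ℝ :=
  (√(2 * b) / σ) ^ n * (Real.Gamma (ρ / b))⁻¹ *
    gaussianMellin (ρ / b + n) (√(2 * b) / σ * (x - a / b))

section

variable {b σ ρ : ℝ} (hb : 0 < b) (hσ : 0 < σ) (hρ : 0 < ρ)
include hb hσ hρ

omit hσ in
theorem hasDerivAt_psiDeriv (a : ℝ) (n : ℕ) (x : ℝ) :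
    HasDerivAt (psiDeriv a b σ ρ n) (psiDeriv a b σ ρ (n + 1) x) x := by
  have hs : 0 < ρ / b + n := by positivity
  have h := (hasDerivAt_gaussianMellin hs (√(2 * b) / σ * (x - a / b))).comp x
    (((hasDerivAt_id x).sub_const (a / b)).const_mul (√(2 * b) / σ))
  refine (h.const_mul ((√(2 * b) / σ) ^ n * (Real.Gamma (ρ / b))⁻¹)).congr_deriv ?_
  rw [psiDeriv, Nat.cast_add, Nat.cast_one, ← add_assoc]
  ring

theorem psiDeriv_pos (a : ℝ) (n : ℕ) (x : ℝ) : 0 < psiDeriv a b σ ρ n x := by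
  have := gaussianMellin_pos (show 0 < ρ / b + n by positivity) (√(2 * b) / σ * (x - a / b))
  have := Real.Gamma_pos_of_pos (show 0 < ρ / b by positivity)
  rw [psiDeriv]
  positivity

theorem monotone_psiDeriv (a : ℝ) (n : ℕ) : Monotone (psiDeriv a b σ ρ n) :=
  monotone_of_deriv_nonneg (fun x => (hasDerivAt_psiDeriv hb hρ a n x).differentiableAt)
    fun x => by
      rw [(hasDerivAt_psiDeriv hb hρ a n x).deriv]
      exact (psiDeriv_pos hb hσ hρ a (n + 1) x).le

theorem psiDeriv_mul_lt {a a' : ℝ} (ha : a < a') (n : ℕ) (x : ℝ) :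
    psiDeriv a b σ ρ n x * psiDeriv a' b σ ρ (n + 1) x <
      psiDeriv a' b σ ρ n x * psiDeriv a b σ ρ (n + 1) x := by
  have hs : 0 < ρ / b + n := by positivity
  have hlt : √(2 * b) / σ * (x - a' / b) < √(2 * b) / σ * (x - a / b) := by gcongr
  have h := strictAnti_gaussianMellin_div hs hlt
  simp only at h
  rw [div_lt_div_iff₀ (gaussianMellin_pos (by linarith) _)
    (gaussianMellin_pos (by linarith) _)] at h
  have := Real.Gamma_pos_of_pos (show 0 < ρ / b by positivity)
  have hk : 0 < (√(2 * b) / σ) ^ n * (Real.Gamma (ρ / b))⁻¹ *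
    ((√(2 * b) / σ) ^ (n + 1) * (Real.Gamma (ρ / b))⁻¹) := by positivity
  have := mul_lt_mul_of_pos_left h hk
  simp only [psiDeriv, Nat.cast_add, Nat.cast_one, ← add_assoc]
  linarith

/-- The case `n = 0` serves the equation in `ψ` and `ψ'`, the case `n = 1` the one in `ψ'` and
`ψ''`. -/
theorem exists_psiDeriv_roots_lt {a a' : ℝ} (ha : a < a') (c : ℝ) (n : ℕ) :
    ∃ x₀ x₀', {x | c < x ∧ (x - c) * psiDeriv a b σ ρ (n + 1) x - psiDeriv a b σ ρ n x = 0} = {x₀} ∧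
      {x | c < x ∧ (x - c) * psiDeriv a' b σ ρ (n + 1) x - psiDeriv a' b σ ρ n x = 0} = {x₀'} ∧
      x₀ < x₀' :=
  exists_roots_lt (hasDerivAt_psiDeriv hb hρ a n) (hasDerivAt_psiDeriv hb hρ a (n + 1))
    (psiDeriv_pos hb hσ hρ a n) (psiDeriv_pos hb hσ hρ a (n + 1))
    (psiDeriv_pos hb hσ hρ a (n + 2)) (monotone_psiDeriv hb hσ hρ a (n + 2))
    (hasDerivAt_psiDeriv hb hρ a' n) (hasDerivAt_psiDeriv hb hρ a' (n + 1))
    (psiDeriv_pos hb hσ hρ a' n) (psiDeriv_pos hb hσ hρ a' (n + 1))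
    (psiDeriv_pos hb hσ hρ a' (n + 2)) (monotone_psiDeriv hb hσ hρ a' (n + 2))
    (psiDeriv_mul_lt hb hσ hρ ha n)

omit hρ in
theorem psi_eq_psiDeriv (a : ℝ) : psi a b σ ρ = psiDeriv a b σ ρ 0 := by
  ext x
  simp [psi_eq hb hσ, psiDeriv]

theorem deriv_psi (a : ℝ) : deriv (psi a b σ ρ) = psiDeriv a b σ ρ 1 := by
  ext x
  rw [psi_eq_psiDeriv hb hσ, (hasDerivAt_psiDeriv hb hρ a 0 x).deriv]

theorem iteratedDeriv_two_psi (a : ℝ) : iteratedDeriv 2 (psi a b σ ρ) = psiDeriv a b σ ρ 2 := by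
  ext x
  rw [iteratedDeriv_succ, iteratedDeriv_one, deriv_psi hb hσ hρ,
    (hasDerivAt_psiDeriv hb hρ a 1 x).deriv]

end

end

end OptimalExtraction

namespace OptimalExtraction

noncomputable section

/-! ### Càdlàg paths -/

/-- Right-continuity and existence of left limits. -/
def IsCadlag (f : ℝ≥0 → ℝ) : Prop :=
  ∀ t, ContinuousWithinAt f (Ici t) t ∧ ∃ l, Tendsto f (𝓝[<] t) (𝓝 l)

theorem _root_.Continuous.isCadlag {f : ℝ≥0 → ℝ} (hf : Continuous f) : IsCadlag f := fun t =>
  ⟨hf.continuousWithinAt, f t, hf.continuousWithinAt.tendsto⟩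

theorem _root_.Monotone.isCadlag {f : ℝ≥0 → ℝ} (hf : Monotone f)
    (h : ∀ t, ContinuousWithinAt f (Ici t) t) : IsCadlag f := fun t =>
  ⟨h t, _, hf.tendsto_leftLim t⟩

theorem IsCadlag.add {f g : ℝ≥0 → ℝ} (hf : IsCadlag f) (hg : IsCadlag g) :
    IsCadlag fun t => f t + g t := fun t => by
  obtain ⟨hf1, l, hl⟩ := hf t
  obtain ⟨hg1, l', hl'⟩ := hg t
  exact ⟨hf1.add hg1, l + l', hl.add hl'⟩

theorem IsCadlag.const_mul {f : ℝ≥0 → ℝ} (hf : IsCadlag f) (r : ℝ) :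
    IsCadlag fun t => r * f t := fun t => by
  obtain ⟨hf1, l, hl⟩ := hf t
  exact ⟨continuousWithinAt_const.mul hf1, r * l, hl.const_mul r⟩

theorem IsCadlag.sub {f g : ℝ≥0 → ℝ} (hf : IsCadlag f) (hg : IsCadlag g) :
    IsCadlag fun t => f t - g t := by
  simpa [sub_eq_add_neg] using hf.add (hg.const_mul (-1))

/-- The one-sided limits bound the path near each point; compactness makes the bound uniform. -/
theorem IsCadlag.exists_bound {f : ℝ≥0 → ℝ} (hf : IsCadlag f) (T : ℝ≥0) :
    ∃ C, ∀ t ≤ T, |f t| ≤ C := by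
  have h : ∃ C, ∀ t ∈ Icc 0 T, |f t| ≤ C := by
    refine isCompact_Icc.induction_on (p := fun s => ∃ C, ∀ t ∈ s, |f t| ≤ C) ⟨0, by simp⟩
      (fun s t hst ⟨C, hC⟩ => ⟨C, fun x hx => hC x (hst hx)⟩) ?_ fun t _ => ?_
    · rintro s t ⟨C, hC⟩ ⟨C', hC'⟩
      exact ⟨max C C', fun x hx => hx.elim (fun h => (hC x h).trans (le_max_left _ _))
        fun h => (hC' x h).trans (le_max_right _ _)⟩
    · obtain ⟨h1, l, hl⟩ := hf t
      have e1 : ∀ᶠ s in 𝓝[≥] t, |f s| ≤ max (|f t| + 1) (|l| + 1) := by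
        filter_upwards [h1.tendsto.abs.eventually_lt_const (lt_add_one _)] with s hs
        exact hs.le.trans (le_max_left _ _)
      have e2 : ∀ᶠ s in 𝓝[<] t, |f s| ≤ max (|f t| + 1) (|l| + 1) := by
        filter_upwards [hl.abs.eventually_lt_const (lt_add_one _)] with s hs
        exact hs.le.trans (le_max_right _ _)
      have e : ∀ᶠ s in 𝓝 t, |f s| ≤ max (|f t| + 1) (|l| + 1) := by
        rw [← nhdsLT_sup_nhdsGE]
        exact eventually_sup.2 ⟨e2, e1⟩
      exact ⟨_, mem_nhdsWithin_of_mem_nhds e, _, fun x hx => hx⟩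
  obtain ⟨C, hC⟩ := h
  exact ⟨C, fun t ht => hC t ⟨zero_le, ht⟩⟩

/-- Rounding up to the grid of mesh `1 / (n + 1)`: each approximation samples a process at countably
many times, from the side where it is continuous. -/
theorem exists_discretization_nhdsGE : ∃ (q : ℕ → ℕ → ℝ≥0) (k : ℕ → ℝ≥0 → ℕ),
    (∀ n, Measurable (k n)) ∧ ∀ s, Tendsto (fun n => q n (k n s)) atTop (𝓝[≥] s) := by
  refine ⟨fun n j => ((j : ℝ≥0) + 1) / (n + 1), fun n s => ⌊((n : ℝ≥0) + 1) * s⌋₊,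
    fun n => Nat.measurable_floor.comp (measurable_id.const_mul _), fun s => ?_⟩
  have h1 : ∀ n : ℕ, s ≤ ((⌊((n : ℝ≥0) + 1) * s⌋₊ : ℝ≥0) + 1) / (n + 1) := fun n => by
    rw [le_div_iff₀ (by positivity), mul_comm]
    exact (Nat.lt_floor_add_one _).le
  have h2 : ∀ n : ℕ, ((⌊((n : ℝ≥0) + 1) * s⌋₊ : ℝ≥0) + 1) / (n + 1) ≤
      s + 1 / ((n : ℝ≥0) + 1) := fun n => by
    rw [add_div]
    refine add_le_add ?_ le_rfl
    rw [div_le_iff₀ (by positivity), mul_comm s]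
    exact Nat.floor_le zero_le
  refine tendsto_nhdsWithin_iff.2 ⟨?_, Eventually.of_forall h1⟩
  refine tendsto_of_tendsto_of_tendsto_of_le_of_le tendsto_const_nhds ?_ h1 h2
  simpa using (tendsto_one_div_add_atTop_nhds_zero_nat (𝕜 := ℝ≥0)).const_add s

/-- A right-continuous process is jointly measurable. -/
theorem measurable_uncurry_of_rightContinuous {Ω : Type*} [MeasurableSpace Ω]
    {u : ℝ≥0 → Ω → ℝ} (hu : ∀ t, Measurable (u t))
    (hc : ∀ ω t, ContinuousWithinAt (fun s => u s ω) (Ici t) t) :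
    Measurable (Function.uncurry u) := by
  obtain ⟨q, k, hk, hq⟩ := exists_discretization_nhdsGE
  refine measurable_of_tendsto_metrizable (f := fun n p => u (q n (k n p.1)) p.2) (fun n => ?_) ?_
  · have h1 : Measurable fun r : ℕ × Ω => u (q n r.1) r.2 :=
      measurable_from_prod_countable_right fun j => hu (q n j)
    exact h1.comp (((hk n).comp measurable_fst).prodMk measurable_snd)
  · exact tendsto_pi_nhds.2 fun p => (hc p.2 p.1).tendsto.comp (hq p.1)

theorem IsCadlag.measurable {f : ℝ≥0 → ℝ} (hf : IsCadlag f) : Measurable f :=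
  (measurable_uncurry_of_rightContinuous (u := fun t (_ : Unit) => f t)
    (fun _ => measurable_const) fun _ t => (hf t).1).comp 
    (measurable_id.prodMk (measurable_const (a := ())))

theorem IsCadlag.intervalIntegrable {f : ℝ≥0 → ℝ} (hf : IsCadlag f) (r s : ℝ) :
    IntervalIntegrable (fun t : ℝ => f t.toNNReal) volume r s := by
  obtain ⟨C, hC⟩ := hf.exists_bound (max r s).toNNReal
  refine (intervalIntegrable_const (c := C)).mono_fun'
    (hf.measurable.comp measurable_real_toNNReal).aestronglyMeasurable ?_
  filter_upwards [ae_restrict_mem measurableSet_uIoc] with t ht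
  exact hC _ (Real.toNNReal_le_toNNReal ht.2)

theorem IsCadlag.continuousWithinAt_toNNReal {f : ℝ≥0 → ℝ} (hf : IsCadlag f) (t : ℝ) :
    ContinuousWithinAt (fun s : ℝ => f s.toNNReal) (Ici t) t :=
  (hf t.toNNReal).1.comp continuous_real_toNNReal.continuousWithinAt
    fun _ hs => Real.toNNReal_le_toNNReal hs

/-! ### Linear integral equations with càdlàg input -/

/-- The solution of `x = z - b ∫ x`. -/
def linearSolution (b : ℝ) (z : ℝ≥0 → ℝ) (t : ℝ≥0) : ℝ :=
  z t - b * (Real.exp (-(b * t)) * ∫ s in (0 : ℝ)..t, Real.exp (b * s) * z s.toNNReal)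

theorem IsCadlag.intervalIntegrable_exp_mul {z : ℝ≥0 → ℝ} (hz : IsCadlag z) (b r s : ℝ) :
    IntervalIntegrable (fun s : ℝ => Real.exp (b * s) * z s.toNNReal) volume r s :=
  (hz.intervalIntegrable r s).continuousOn_mul (by fun_prop)

theorem IsCadlag.continuous_integral_exp_mul {z : ℝ≥0 → ℝ} (hz : IsCadlag z) (b : ℝ) :
    Continuous fun t : ℝ =>
      Real.exp (-(b * t)) * ∫ s in (0 : ℝ)..t, Real.exp (b * s) * z s.toNNReal :=
  (by fun_prop : Continuous fun t : ℝ => Real.exp (-(b * t))).mul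
    (intervalIntegral.continuous_primitive (fun r s => hz.intervalIntegrable_exp_mul b r s) 0)

theorem IsCadlag.linearSolution {z : ℝ≥0 → ℝ} (hz : IsCadlag z) (b : ℝ) :
    IsCadlag (linearSolution b z) :=
  hz.sub (((hz.continuous_integral_exp_mul b).comp NNReal.continuous_coe).isCadlag.const_mul b)

/-- Variation of constants. Since `z` is only right-continuous, the fundamental theorem of calculus
is used with right derivatives. -/
theorem IsCadlag.integral_linearSolution {z : ℝ≥0 → ℝ} (hz : IsCadlag z) (b : ℝ) (t : ℝ≥0) :
    ∫ s in (0 : ℝ)..t, OptimalExtraction.linearSolution b z s.toNNReal =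
      Real.exp (-(b * t)) * ∫ s in (0 : ℝ)..t, Real.exp (b * s) * z s.toNNReal := by
  have h := intervalIntegral.integral_eq_sub_of_hasDeriv_right_of_le (a := 0) (b := (t : ℝ))
    (f' := fun s => OptimalExtraction.linearSolution b z s.toNNReal) t.2
    (hz.continuous_integral_exp_mul b).continuousOn (fun s hs => ?_)
    ((hz.linearSolution b).intervalIntegrable _ _)
  · rw [h]; simp
  · have hc : ContinuousWithinAt (fun s : ℝ => Real.exp (b * s) * z s.toNNReal) (Ici s) s :=
      (by fun_prop : Continuous fun s : ℝ => Real.exp (b * s)).continuousWithinAt.mul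
        (hz.continuousWithinAt_toNNReal s)
    have hm : Measurable fun s : ℝ => Real.exp (b * s) * z s.toNNReal :=
      (by fun_prop : Measurable fun s : ℝ => Real.exp (b * s)).mul
        (hz.measurable.comp measurable_real_toNNReal)
    have h1 : HasDerivWithinAt (fun t : ℝ => ∫ s in (0 : ℝ)..t, Real.exp (b * s) * z s.toNNReal)
        (Real.exp (b * s) * z s.toNNReal) (Ioi s) s :=
      (intervalIntegral.integral_hasDerivWithinAt_right (hz.intervalIntegrable_exp_mul b 0 s)
        (s := Ici s) (t := Ioi s) hm.stronglyMeasurable.stronglyMeasurableAtFilter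
        (hc.mono Ioi_subset_Ici_self)).mono Ioi_subset_Ici_self
    have h2 : HasDerivAt (fun t : ℝ => Real.exp (-(b * t))) (Real.exp (-(b * s)) * -b) s := by
      simpa using (((hasDerivAt_id s).const_mul b).neg).exp
    refine (h2.hasDerivWithinAt.mul h1).congr_deriv ?_
    have he : Real.exp (-(b * s)) * Real.exp (b * s) = 1 := by
      rw [← Real.exp_add]; simp
    rw [OptimalExtraction.linearSolution, Real.coe_toNNReal s hs.1.le, ← mul_assoc, he]
    ring

theorem eq_of_linear_integral_equation {b δ : ℝ} (hb : b ≠ 0) {d : ℝ≥0 → ℝ} (hd : IsCadlag d)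
    (h : ∀ t : ℝ≥0, d t = δ * t - b * ∫ s in (0 : ℝ)..t, d s.toNNReal) (t : ℝ≥0) :
    d t = δ / b * (1 - Real.exp (-(b * t))) := by
  -- `E` agrees with `d` on `[0, ∞)` but is visibly continuous, so its primitive is differentiable
  -- and the integrating factor `exp (b t)` applies.
  set E : ℝ → ℝ := fun t => δ * t - b * ∫ s in (0 : ℝ)..t, d s.toNNReal with hE
  have hEd : ∀ t : ℝ, 0 ≤ t → E t = d t.toNNReal := fun t ht => by
    rw [h, Real.coe_toNNReal t ht]
  have hEc : Continuous E := by
    have := intervalIntegral.continuous_primitive (fun r s => hd.intervalIntegrable r s) 0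
    fun_prop
  have hint : ∀ t : ℝ, 0 ≤ t → E t = δ * t - b * ∫ s in (0 : ℝ)..t, E s := fun t ht => by
    simp only [hE]
    congr 2
    refine intervalIntegral.integral_congr fun s hs => ?_
    rw [uIcc_of_le ht] at hs
    exact (hEd s hs.1).symm
  set g : ℝ → ℝ := fun t => Real.exp (b * t) * (δ * t - b * (∫ s in (0 : ℝ)..t, E s) - δ / b)
    with hg
  have hgd : ∀ t, 0 ≤ t → HasDerivAt g 0 t := fun t ht => by
    have h1 : HasDerivAt (fun t => ∫ s in (0 : ℝ)..t, E s) (E t) t :=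
      hEc.integral_hasStrictDerivAt 0 t |>.hasDerivAt
    have h2 := (((hasDerivAt_id' t).const_mul b).exp).mul
      ((((hasDerivAt_id' t).const_mul δ).sub (h1.const_mul b)).sub_const (δ / b))
    refine h2.congr_deriv ?_
    have h3 := hint t ht
    have h4 : b * (δ / b) = δ := by field_simp
    simp only [Pi.sub_apply]
    linear_combination (-(Real.exp (b * t) * b)) * h3 - Real.exp (b * t) * h4
  have hconst : g t = g 0 := constant_of_has_deriv_right_zero (a := 0) (b := (t : ℝ))
    (fun s hs => (hgd s hs.1).continuousAt.continuousWithinAt)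
    (fun s hs => (hgd s hs.1).hasDerivWithinAt) t ⟨t.2, le_rfl⟩
  simp only [hg] at hconst
  rw [← hint t t.2, hEd t t.2, Real.toNNReal_coe] at hconst
  have he : Real.exp (-(b * t)) * Real.exp (b * t) = 1 := by
    rw [← Real.exp_add]; simp
  simp only [mul_zero, Real.exp_zero, intervalIntegral.integral_same, one_mul] at hconst
  linear_combination Real.exp (-(b * t)) * hconst + (δ / b - d t) * he

end

end OptimalExtraction

namespace OptimalExtraction

noncomputable section

variable {Ω : Type*} [mΩ : MeasurableSpace Ω]

/-! ### The controlled price -/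

theorem continuousWithinAt_comp_min {f : ℝ≥0 → ℝ} (hf : ∀ t, ContinuousWithinAt f (Ici t) t)
    (T t : ℝ≥0) : ContinuousWithinAt (fun s => f (min s T)) (Ici t) t :=
  (hf (min t T)).comp (f := fun s => min s T) (by fun_prop) fun _ hs => min_le_min_right T hs

/-- Freezing `u` at time `T` leaves the integral unchanged and uses measurability only up to `T`, as
adaptedness requires. -/
theorem measurable_integral_exp_mul {u : ℝ≥0 → Ω → ℝ} (T : ℝ≥0)
    (hu : ∀ t ≤ T, Measurable (u t))
    (hc : ∀ ω t, ContinuousWithinAt (fun s => u s ω) (Ici t) t) (b : ℝ) :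
    Measurable fun ω => ∫ s in (0 : ℝ)..T, Real.exp (b * s) * u s.toNNReal ω := by
  have h1 : Measurable (Function.uncurry fun (t : ℝ≥0) ω => u (min t T) ω) :=
    measurable_uncurry_of_rightContinuous (fun t => hu _ (min_le_right _ _))
      fun ω t => continuousWithinAt_comp_min (hc ω) T t
  have h2 : Measurable fun p : ℝ × Ω => Real.exp (b * p.1) * u (min p.1.toNNReal T) p.2 :=
    (by fun_prop : Measurable fun p : ℝ × Ω => Real.exp (b * p.1)).mul
      (h1.comp ((measurable_real_toNNReal.comp measurable_fst).prodMk measurable_snd))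
  have h3 := (h2.stronglyMeasurable.integral_prod_left'
    (μ := volume.restrict (Ioc (0 : ℝ) T))).measurable
  convert h3 using 2 with ω
  rw [intervalIntegral.integral_of_le (NNReal.coe_nonneg T)]
  refine setIntegral_congr_fun measurableSet_Ioc fun s hs => ?_
  simp only
  rw [min_eq_left (Real.toNNReal_le_iff_le_coe.2 hs.2)]

theorem measurableSet_augmentedFiltration_of_null {P : Measure Ω} {W : ℝ≥0 → Ω → ℝ}
    (hW : ∀ t, Measurable (W t)) (t : ℝ≥0) {N : Set Ω} (hN : MeasurableSet N) (hPN : P N = 0) :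
    MeasurableSet[augmentedFiltration P W hW t] N :=
  (le_sup_right : _ ≤ (⨆ s ≤ t, MeasurableSpace.comap (W s) (borel ℝ)) ⊔
    MeasurableSpace.generateFrom {N | MeasurableSet N ∧ P N = 0}) _
    (MeasurableSpace.measurableSet_generateFrom ⟨hN, hPN⟩)

theorem measurable_augmentedFiltration {P : Measure Ω} {W : ℝ≥0 → Ω → ℝ}
    (hW : ∀ t, Measurable (W t)) (t : ℝ≥0) : Measurable[augmentedFiltration P W hW t] (W t) := by
  rw [measurable_iff_comap_le, BorelSpace.measurable_eq (α := ℝ)]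
  exact (le_iSup₂_of_le t le_rfl le_rfl : MeasurableSpace.comap (W t) (borel ℝ) ≤
    ⨆ s ≤ t, MeasurableSpace.comap (W s) (borel ℝ)).trans le_sup_left

/-- The equation is solved path by path with input `x + a t + σ W - α ξ`. The input is set to zero
on a null set containing all irregular paths; that set lies in every augmented σ-algebra, so
adaptedness survives. -/
theorem exists_isPrice {P : Measure Ω} {W : ℝ≥0 → Ω → ℝ} (hWm : ∀ t, Measurable (W t))
    (hW : ∀ᵐ ω ∂P, Continuous (W · ω)) (a b σ α x : ℝ) {y : ℝ} {ξ : ℝ≥0 → Ω → ℝ}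
    (hξ : IsAdmissible (augmentedFiltration P W hWm) P y ξ) :
    ∃ X, IsPrice (augmentedFiltration P W hWm) P W a b σ α x ξ X := by
  set 𝓕 := augmentedFiltration P W hWm
  obtain ⟨N, hNsub, hNm, hPN⟩ := exists_measurable_superset_of_null
    (ae_iff.1 (hW.and (hξ.mono.and hξ.rightCont)))
  have hgood : ∀ ω ∉ N, IsCadlag fun t => x + a * t + σ * W t ω - α * ξ t ω := fun ω hω => by
    have hω' : Continuous (W · ω) ∧ Monotone (ξ · ω) ∧
        ∀ t, ContinuousWithinAt (fun s => ξ s ω) (Ici t) t :=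
      not_not.1 fun h => hω (hNsub h)
    obtain ⟨h1, h2, h3⟩ := hω'
    exact (by fun_prop : Continuous fun t : ℝ≥0 => x + a * t + σ * W t ω).isCadlag.sub
      ((h2.isCadlag h3).const_mul α)
  set Z : ℝ≥0 → Ω → ℝ := fun t => Nᶜ.indicator fun ω => x + a * t + σ * W t ω - α * ξ t ω with hZ
  have hZc : ∀ ω, IsCadlag (Z · ω) := fun ω => by
    by_cases hω : ω ∈ N
    · simpa [hZ, hω] using (continuous_const (y := (0 : ℝ))).isCadlag
    · simpa [hZ, hω] using hgood ω hω
  have hZm : ∀ t, Measurable[𝓕 t] (Z t) := fun t => by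
    have h1 : Measurable[𝓕 t] (W t) := measurable_augmentedFiltration hWm t
    have h2 : Measurable[𝓕 t] (ξ t) := (hξ.adapted t).measurable
    have h3 : MeasurableSet[𝓕 t] Nᶜ :=
      (measurableSet_augmentedFiltration_of_null hWm t hNm hPN).compl
    exact (((h1.const_mul σ).const_add (x + a * t)).sub (h2.const_mul α)).indicator h3
  refine ⟨fun t ω => linearSolution b (Z · ω) t, fun t => ?_,
    Eventually.of_forall fun ω => (hZc ω).linearSolution b, ?_⟩
  · have h := @measurable_integral_exp_mul Ω (𝓕 t) Z t (fun s hs => (hZm s).mono (𝓕.mono hs) le_rfl)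
      (fun ω s => (hZc ω s).1) b
    exact ((hZm t).sub ((h.const_mul _).const_mul b)).stronglyMeasurable
  · filter_upwards [measure_eq_zero_iff_ae_notMem.1 hPN] with ω hω t
    rw [intervalIntegral.integral_sub intervalIntegrable_const
      ((((hZc ω).linearSolution b).intervalIntegrable _ _).const_mul b),
      intervalIntegral.integral_const_mul, (hZc ω).integral_linearSolution]
    simp only [linearSolution, hZ, indicator, mem_compl_iff, hω, not_false_iff, if_true,
      intervalIntegral.integral_const, smul_eq_mul, sub_zero]
    ring

theorem IsPrice.ae_eq_add {𝓕 : Filtration ℝ≥0 mΩ} {P : Measure Ω} {W : ℝ≥0 → Ω → ℝ}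
    {a a' b σ α x : ℝ} {ξ X X' : ℝ≥0 → Ω → ℝ} (hb : b ≠ 0)
    (hX : IsPrice 𝓕 P W a b σ α x ξ X) (hX' : IsPrice 𝓕 P W a' b σ α x ξ X') :
    ∀ᵐ ω ∂P, ∀ t, X' t ω = X t ω + (a' - a) / b * (1 - Real.exp (-(b * t))) := by
  filter_upwards [hX.cadlag, hX'.cadlag, hX.eqn, hX'.eqn] with ω h1 h1' h2 h2' t
  have hc : IsCadlag (X · ω) := h1
  have hc' : IsCadlag (X' · ω) := h1'
  rw [← eq_of_linear_integral_equation hb (hc'.sub hc), add_sub_cancel]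
  intro t
  rw [h2, h2', intervalIntegral.integral_sub intervalIntegrable_const
    ((hc.intervalIntegrable _ _).const_mul b), intervalIntegral.integral_sub
    intervalIntegrable_const ((hc'.intervalIntegrable _ _).const_mul b),
    intervalIntegral.integral_const_mul, intervalIntegral.integral_const_mul,
    intervalIntegral.integral_sub (hc'.intervalIntegrable _ _) (hc.intervalIntegrable _ _)]
  simp only [intervalIntegral.integral_const, smul_eq_mul, sub_zero]
  ring

/-! ### Monotonicity of the profit in the price path -/

/-- When the difference is integrable, `f` and `g` are integrable together or not at all; in the
latter case both integrals take the default value zero. -/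
theorem integral_le_integral_of_integrable_sub {β : Type*} [MeasurableSpace β] {μ : Measure β}
    {f g : β → ℝ} (hfg : f ≤ g) (h : Integrable (g - f) μ) : ∫ t, f t ∂μ ≤ ∫ t, g t ∂μ := by
  by_cases hf : Integrable f μ
  · exact integral_mono hf (by simpa using h.add hf) hfg
  · have hg : ¬ Integrable g μ := fun hg => hf (by simpa using hg.sub h)
    rw [integral_undef hf, integral_undef hg]

theorem tsum_le_tsum_of_summable_sub {β : Type*} {f g : β → ℝ} (hfg : f ≤ g)
    (h : Summable (g - f)) : ∑' t, f t ≤ ∑' t, g t := by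
  by_cases hf : Summable f
  · exact hf.tsum_le_tsum hfg (by simpa using h.add hf)
  · have hg : ¬ Summable g := fun hg => hf (by simpa using hg.sub h)
    rw [tsum_eq_zero_of_not_summable hf, tsum_eq_zero_of_not_summable hg]

section Path

variable {k : ℝ≥0 → ℝ} {y : ℝ}

theorem leftValue_le (hk : Monotone k) (h0 : ∀ t, 0 ≤ k t) (t : ℝ≥0) : leftValue 0 k t ≤ k t := by
  rw [leftValue]
  split_ifs
  · exact h0 t
  · exact hk.leftLim_le le_rfl

theorem le_leftValue (hk : Monotone k) {s t : ℝ≥0} (hst : s < t) : k s ≤ leftValue 0 k t := by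
  rw [leftValue, if_neg (zero_le.trans_lt hst).ne']
  exact hk.le_leftLim hst

theorem jump_nonneg (hk : Monotone k) (h0 : ∀ t, 0 ≤ k t) (t : ℝ≥0) : 0 ≤ jump k t :=
  sub_nonneg.2 (leftValue_le hk h0 t)

/-- Induction on the largest time `u`: the earlier jumps add up to at most the left limit at `u`,
and the jump at `u` fills the gap to `k u`. -/
theorem sum_jump_le (hk : Monotone k) (h0 : ∀ t, 0 ≤ k t) (s : Finset ℝ≥0) :
    ∀ r, (∀ t ∈ s, t ≤ r) → ∑ t ∈ s, jump k t ≤ k r := by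
  induction s using Finset.induction_on_max with
  | empty => simpa using h0
  | insert u s hs ih =>
    intro r hr
    have hsum : ∑ t ∈ s, jump k t ≤ leftValue 0 k u := by
      rcases s.eq_empty_or_nonempty with rfl | hne
      · rcases eq_or_ne u 0 with rfl | hu
        · simp [leftValue]
        · simpa using (h0 0).trans (le_leftValue hk (pos_iff_ne_zero.2 hu))
      · exact (ih _ fun t ht => s.le_max' t ht).trans (le_leftValue hk (hs _ (s.max'_mem hne)))
    rw [Finset.sum_insert fun hu => (hs u hu).false]
    have := hk (hr u (Finset.mem_insert_self u s))
    rw [jump]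
    linarith

theorem summable_jump (hk : Monotone k) (h0 : ∀ t, 0 ≤ k t) (hy : ∀ t, k t ≤ y) :
    Summable (jump k) :=
  summable_of_sum_le (jump_nonneg hk h0) fun s =>
    (sum_jump_le hk h0 s _ fun _ ht => s.le_sup (f := id) ht).trans (hy _)

theorem continuousPart_mem_Icc (hk : Monotone k) (h0 : ∀ t, 0 ≤ k t) (hy : ∀ t, k t ≤ y)
    (t : ℝ≥0) : continuousPart k t ∈ Icc 0 y := by
  have h1 : ∑' s : Iic t, jump k s ≤ k t := by
    refine ((summable_jump hk h0 hy).subtype (Iic t)).tsum_le_of_sum_le fun s => ?_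
    have := sum_jump_le hk h0 (s.map (Function.Embedding.subtype _)) t fun r hr => by
      obtain ⟨q, -, rfl⟩ := Finset.mem_map.1 hr
      exact q.2
    rwa [Finset.sum_map] at this
  have h2 : 0 ≤ ∑' s : Iic t, jump k s := tsum_nonneg fun s => jump_nonneg hk h0 s
  exact ⟨sub_nonneg.2 h1, (sub_le_self _ h2).trans (hy t)⟩

theorem isFiniteMeasure_continuousPartMeasure (hk : Monotone k) (h0 : ∀ t, 0 ≤ k t)
    (hy : ∀ t, k t ≤ y) : IsFiniteMeasure (continuousPartMeasure k) := by
  rw [continuousPartMeasure]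
  -- Whether the continuous part is monotone need not be decided: otherwise the measure is zero.
  split_ifs with h
  · refine StieltjesFunction.isFiniteMeasure_of_forall_abs_le _ (C := y) fun t => ?_
    rw [h.stieltjesFunction_eq, abs_of_nonneg
      ((continuousPart_mem_Icc hk h0 hy t).1.trans (h.le_rightLim le_rfl))]
    exact (h.rightLim_le (lt_add_one t)).trans (continuousPart_mem_Icc hk h0 hy _).2
  · infer_instance

theorem leftValue_add {p d : ℝ≥0 → ℝ} (hp : IsCadlag p) (hd : Continuous d) (x : ℝ) {t : ℝ≥0}
    (ht : t ≠ 0) : leftValue x (fun s => p s + d s) t = leftValue x p t + d t := by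
  obtain ⟨-, l, hl⟩ := hp t
  have : NeBot (𝓝[<] t) := nhdsLT_neBot_of_exists_lt ⟨0, pos_iff_ne_zero.2 ht⟩
  rw [leftValue, leftValue, if_neg ht, if_neg ht, leftLim_eq_of_tendsto hl,
    leftLim_eq_of_tendsto (hl.add hd.continuousWithinAt.tendsto)]

/-- The price shift `d` is bounded and the control has finite total mass, so the profit difference
is integrable and summable even if the profits themselves are not. -/
theorem pathProfit_le_pathProfit_add {ρ : ℝ} (hρ : 0 ≤ ρ) (c α x : ℝ) (hk : Monotone k)
    (h0 : ∀ t, 0 ≤ k t) (hy : ∀ t, k t ≤ y) {p d : ℝ≥0 → ℝ} (hp : IsCadlag p) (hd : Continuous d)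
    {C : ℝ} (hd0 : ∀ t, 0 ≤ d t) (hdC : ∀ t, d t ≤ C) :
    pathProfit ρ c α x k p ≤ pathProfit ρ c α x k (fun t => p t + d t) := by
  have hfin := isFiniteMeasure_continuousPartMeasure hk h0 hy
  have hexp : ∀ t : ℝ≥0, Real.exp (-ρ * t) ≤ 1 := fun t => Real.exp_le_one_iff.2 (by
    have := mul_nonneg hρ t.2
    simpa using this)
  have hC : 0 ≤ C := (hd0 0).trans (hdC 0)
  refine add_le_add (integral_le_integral_of_integrable_sub (fun t => ?_) ?_)
    (tsum_le_tsum_of_summable_sub (fun t => ?_) ?_)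
  · have := hd0 t
    simp only
    gcongr
    linarith
  · have he : ((fun t : ℝ≥0 => Real.exp (-ρ * t) * (p t + d t - c)) -
        fun t : ℝ≥0 => Real.exp (-ρ * t) * (p t - c)) = fun t : ℝ≥0 => Real.exp (-ρ * t) * d t := by
      ext t
      simp only [Pi.sub_apply]
      ring
    rw [he]
    refine (integrable_const C).mono' (by fun_prop) (Eventually.of_forall fun t => ?_)
    rw [Real.norm_of_nonneg (mul_nonneg (Real.exp_pos _).le (hd0 t))]
    nlinarith [hexp t, hd0 t, hdC t]
  · have := jump_nonneg hk h0 t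
    simp only
    gcongr
    by_cases ht : (t : ℝ≥0) = 0
    · simp [leftValue, ht]
    · rw [leftValue_add hp hd x ht]
      linarith [hd0 t]
  · refine Summable.of_norm_bounded (g := fun t : {t // jump k t ≠ 0} => C * jump k t)
      (((summable_jump hk h0 hy).subtype _).mul_left C) fun t => ?_
    have hj := jump_nonneg hk h0 t
    have he : 0 ≤ leftValue x (fun s => p s + d s) t - leftValue x p t ∧
        leftValue x (fun s => p s + d s) t - leftValue x p t ≤ C := by
      -- At time zero both left values are the common initial price `x`, so the shift does not
      -- enter.
      by_cases ht : (t : ℝ≥0) = 0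
      · simpa [leftValue, ht] using hC
      · rw [leftValue_add hp hd x ht, add_sub_cancel_left]
        exact ⟨hd0 t, hdC t⟩
    have heq : Real.exp (-ρ * (t : ℝ≥0)) *
        ((leftValue x (fun s => p s + d s) t - c) * jump k t - 1 / 2 * α * jump k t ^ 2) -
        Real.exp (-ρ * (t : ℝ≥0)) *
        ((leftValue x p t - c) * jump k t - 1 / 2 * α * jump k t ^ 2) =
        Real.exp (-ρ * (t : ℝ≥0)) *
          (leftValue x (fun s => p s + d s) t - leftValue x p t) * jump k t := by
      ring
    rw [Pi.sub_apply, heq, Real.norm_of_nonneg (mul_nonneg (mul_nonneg (Real.exp_pos _).le he.1) hj)]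
    refine mul_le_mul_of_nonneg_right ?_ hj
    nlinarith [hexp t]

end Path

/-- Positive and negative parts are compared separately, so no integrability is needed. -/
theorem expectation_mono {P : Measure Ω} {Z Z' : Ω → ℝ} (h : ∀ᵐ ω ∂P, Z ω ≤ Z' ω) :
    expectation P Z ≤ expectation P Z' := by
  refine EReal.sub_le_sub ?_ ?_
  · exact EReal.coe_ennreal_le_coe_ennreal_iff.2 (lintegral_mono_ae (by
      filter_upwards [h] with ω hω using ENNReal.ofReal_le_ofReal hω))
  · exact EReal.coe_ennreal_le_coe_ennreal_iff.2 (lintegral_mono_ae (by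
      filter_upwards [h] with ω hω using ENNReal.ofReal_le_ofReal (neg_le_neg hω)))

theorem one_sub_exp_neg_mem_Icc {b : ℝ} (hb : 0 < b) (t : ℝ≥0) :
    1 - Real.exp (-(b * t)) ∈ Icc (0 : ℝ) 1 :=
  ⟨sub_nonneg.2 (Real.exp_le_one_iff.2 (neg_nonpos.2 (mul_nonneg hb.le t.2))),
    sub_le_self _ (Real.exp_pos _).le⟩

theorem performance_mono {𝓕 : Filtration ℝ≥0 mΩ} {P : Measure Ω} {W : ℝ≥0 → Ω → ℝ}
    {a a' b σ ρ α x y : ℝ} (c : ℝ) (ha : a ≤ a') (hb : 0 < b) (hρ : 0 ≤ ρ)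
    {ξ X X' : ℝ≥0 → Ω → ℝ} (hξ : IsAdmissible 𝓕 P y ξ)
    (hX : IsPrice 𝓕 P W a b σ α x ξ X) (hX' : IsPrice 𝓕 P W a' b σ α x ξ X') :
    performance P ρ c α x ξ X ≤ performance P ρ c α x ξ X' := by
  refine expectation_mono ?_
  filter_upwards [hX.ae_eq_add hb.ne' hX', hX.cadlag, hξ.mono, hξ.nonneg, hξ.le]
    with ω h hc hmono h0 hy
  have hδ : 0 ≤ (a' - a) / b := div_nonneg (sub_nonneg.2 ha) hb.le
  rw [funext h]
  exact pathProfit_le_pathProfit_add hρ c α x hmono h0 hy hc (by fun_prop) (C := (a' - a) / b)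
    (fun t => mul_nonneg hδ (one_sub_exp_neg_mem_Icc hb t).1)
    fun t => mul_le_of_le_one_right hδ (one_sub_exp_neg_mem_Icc hb t).2

end

end OptimalExtraction

theorem mainTheorem10 {Ω : Type*} [MeasurableSpace Ω] (P : Measure Ω) [IsProbabilityMeasure P]
    (W : ℝ≥0 → Ω → ℝ) (hWm : ∀ t, Measurable (W t)) (hW : IsBrownianReal W P)
    (a a' b σ ρ c α : ℝ) (ha : a < a') (hb : 0 < b) (hσ : 0 < σ) (hρ : 0 < ρ) (hc : 0 < c)
    (hα : 0 < α) :
    (∃ x₀ x₀' : ℝ,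
      {x | c < x ∧ (x - c) * deriv (OptimalExtraction.psi a b σ ρ) x
        - OptimalExtraction.psi a b σ ρ x = 0} = {x₀} ∧
      {x | c < x ∧ (x - c) * deriv (OptimalExtraction.psi a' b σ ρ) x
        - OptimalExtraction.psi a' b σ ρ x = 0} = {x₀'} ∧
      x₀ < x₀') ∧
    (∃ xInf xInf' : ℝ,
      {x | c < x ∧ (x - c) * iteratedDeriv 2 (OptimalExtraction.psi a b σ ρ) x
        - deriv (OptimalExtraction.psi a b σ ρ) x = 0} = {xInf} ∧
      {x | c < x ∧ (x - c) * iteratedDeriv 2 (OptimalExtraction.psi a' b σ ρ) x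
        - deriv (OptimalExtraction.psi a' b σ ρ) x = 0} = {xInf'} ∧
      xInf < xInf') ∧
    (∀ x y : ℝ, 0 ≤ y → ∀ ξ : ℝ≥0 → Ω → ℝ,
      OptimalExtraction.IsAdmissible (OptimalExtraction.augmentedFiltration P W hWm) P y ξ →
      (∃ X, OptimalExtraction.IsPrice (OptimalExtraction.augmentedFiltration P W hWm)
        P W a b σ α x ξ X) ∧
      (∃ X', OptimalExtraction.IsPrice (OptimalExtraction.augmentedFiltration P W hWm)
        P W a' b σ α x ξ X') ∧
      ∀ X X' : ℝ≥0 → Ω → ℝ,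
        OptimalExtraction.IsPrice (OptimalExtraction.augmentedFiltration P W hWm)
          P W a b σ α x ξ X →
        OptimalExtraction.IsPrice (OptimalExtraction.augmentedFiltration P W hWm)
          P W a' b σ α x ξ X' →
        ∀ᵐ ω ∂P, ∀ t, X t ω ≤ X' t ω) ∧
    (∀ x y : ℝ, 0 ≤ y →
      OptimalExtraction.value (OptimalExtraction.augmentedFiltration P W hWm)
          P W a b σ ρ c α x y ≤
        OptimalExtraction.value (OptimalExtraction.augmentedFiltration P W hWm)
          P W a' b σ ρ c α x y) := by 
  have hWc : ∀ᵐ ω ∂P, Continuous (W · ω) := hW.cont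
  refine ⟨?_, ?_, fun x y _ ξ hξ => ⟨OptimalExtraction.exists_isPrice hWm hWc a b σ α x hξ,
    OptimalExtraction.exists_isPrice hWm hWc a' b σ α x hξ, fun X X' hX hX' => ?_⟩,
    fun x y _ => ?_⟩
  · simp only [OptimalExtraction.deriv_psi hb hσ hρ]
    simp only [OptimalExtraction.psi_eq_psiDeriv hb hσ]
    exact OptimalExtraction.exists_psiDeriv_roots_lt hb hσ hρ ha c 0
  · simp only [OptimalExtraction.iteratedDeriv_two_psi hb hσ hρ,
      OptimalExtraction.deriv_psi hb hσ hρ]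
    exact OptimalExtraction.exists_psiDeriv_roots_lt hb hσ hρ ha c 1
  · filter_upwards [hX.ae_eq_add hb.ne' hX'] with ω h t
    rw [h]
    exact le_add_of_nonneg_right (mul_nonneg (div_nonneg (sub_nonneg.2 ha.le) hb.le)
      (OptimalExtraction.one_sub_exp_neg_mem_Icc hb t).1)
  · refine sSup_le ?_
    rintro v ⟨ξ, X, hξ, hX, rfl⟩
    -- The same control competes in the problem with drift `a'`, where it does at least as well.
    obtain ⟨X', hX'⟩ := OptimalExtraction.exists_isPrice hWm hWc a' b σ α x hξ
    exact (OptimalExtraction.performance_mono c ha.le hb hρ.le hξ hX hX').trans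
      (le_sSup ⟨ξ, X', hξ, hX', rfl⟩)
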